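/- Let $\mathcal H$ be a complex Hilbert space with an orthonormal basis $(e_n)_{n\in\mathbb Z}$, let $(\omega_n)_{n\in\mathbb Z}$ be a bounded sequence of positive real numbers, and let $S$ be the bilateral weighted shift on $\mathcal H$ given by $Se_n=\omega_ne_{n+1}$ for all $n\in\mathbb Z$. Put $\beta_n=\omega_0\cdots\omega_{n-1}$ for $n>0$, $\beta_0=1$, and $\beta_n=\frac{1}{\omega_n\cdots\omega_{-1}}$ for $n<0$, and $$r_2^-(S)=\liminf_{n\to+\infty}\Big[\frac{1}{\beta_{-n}}\Big]^{1/n},\qquad r_3^+(S)=\limsup_{n\to+\infty}\,[\beta_n]^{1/n}.$$ For a non-zero $x=\sum_{n\in\mathbb Z}a_ne_n\in\mathcal H$ put $$R_\omega^+(x)=\liminf_{n\to+\infty}\Big|\frac{\beta_n}{a_n}\Big|^{1/n}\in[0,+\infty],$$ where $|\beta_n/a_n|=+\infty$ if $a_n=0$. The local spectrum $\sigma_S(x)$ is the complement in $\mathbb C$ of the union of all open sets $U\subset\mathbb C$ for which there is an analytic function $f:U\to\mathcal H$ with $(S-\lambda)f(\lambda)=x$ for all $\lambda\in U$. Assume that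 $r_2^-(S)=0$, and let $k\in\mathbb Z$. Then for every non-zero $x$ in the closed linear span of $\{e_n:n\geq k\}$ the following statements hold. (a) If $r_3^+(S)<R_\omega^+(x)$, then $\sigma_S(x)=\{\lambda\in\mathbb C:|\lambda|\leq r_3^+(S)\}$. (b) If $r_3^+(S)\geq R_\omega^+(x)$, then $\{\lambda\in\mathbb C:|\lambda|\leq R_\omega^+(x)\}\subset\sigma_S(x)$. -/

import Mathlib

open scoped ENNReal

/-- The local resolvent set of `T` at `x`: the union of all open sets `U` of complex numbers on
which the equation `(T - z) f(z) = x` has an analytic solution `f`. -/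
def localResolventSet {H : Type*} [NormedAddCommGroup H] [NormedSpace ℂ H]
    (T : H →L[ℂ] H) (x : H) : Set ℂ :=
  ⋃₀ {U : Set ℂ | IsOpen U ∧
    ∃ f : ℂ → H, AnalyticOnNhd ℂ f U ∧ ∀ z ∈ U, T (f z) - z • f z = x}

/-- The local spectrum of `T` at `x`. -/
def localSpectrum {H : Type*} [NormedAddCommGroup H] [NormedSpace ℂ H]
    (T : H →L[ℂ] H) (x : H) : Set ℂ :=
  (localResolventSet T x)ᶜ

/-- `S` is the bilateral weighted shift with the positive bounded weight sequence `ω`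
with respect to the orthonormal basis `e`: `S eₙ = ωₙ eₙ₊₁` for all integers `n`. -/
structure IsBilateralWeightedShift {H : Type*} [NormedAddCommGroup H] [InnerProductSpace ℂ H]
    (e : HilbertBasis ℤ ℂ H) (ω : ℤ → ℝ) (S : H →L[ℂ] H) : Prop where
  weight_pos : ∀ n, 0 < ω n
  weight_bdd : BddAbove (Set.range ω)
  apply_basis : ∀ n, S (e n) = (ω n : ℂ) • e (n + 1)

namespace BilateralShift

/-- `βₙ = ω₀ ⋯ ωₙ₋₁` for `n ≥ 0` (so `β₀ = 1`) and `βₙ = 1 / (ωₙ ⋯ ω₋₁)` for `n < 0`. -/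
noncomputable def beta (ω : ℤ → ℝ) (n : ℤ) : ℝ :=
  if 0 ≤ n then ∏ i ∈ Finset.Ico 0 n, ω i else 1 / ∏ i ∈ Finset.Ico n 0, ω i

/-- `r₂⁻ = liminf (1 / β₋ₙ) ^ (1 / n)` as `n → +∞`, in `[0, ∞]`. -/
noncomputable def r2Minus (ω : ℤ → ℝ) : ℝ≥0∞ :=
  Filter.liminf (fun n : ℕ => ENNReal.ofReal (1 / beta ω (-(n : ℤ))) ^ (1 / (n : ℝ))) Filter.atTop

/-- `r₃⁺ = limsup βₙ ^ (1 / n)` as `n → +∞`, in `[0, ∞]`. -/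
noncomputable def r3Plus (ω : ℤ → ℝ) : ℝ≥0∞ :=
  Filter.limsup (fun n : ℕ => ENNReal.ofReal (beta ω n) ^ (1 / (n : ℝ))) Filter.atTop

/-- `R⁺(x) = liminf (βₙ / |aₙ|) ^ (1 / n)` as `n → +∞`, in `[0, ∞]`, where `aₙ` are the
coordinates of `x` in the basis `e`. The quotient is taken in `[0, ∞]`: it is `∞` if `aₙ = 0`. -/
noncomputable def RPlus {H : Type*} [NormedAddCommGroup H] [InnerProductSpace ℂ H]
    (e : HilbertBasis ℤ ℂ H) (ω : ℤ → ℝ) (x : H) : ℝ≥0∞ :=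
  Filter.liminf
    (fun n : ℕ => (ENNReal.ofReal (beta ω n) / ‖e.repr x (n : ℤ)‖ₑ) ^ (1 / (n : ℝ))) Filter.atTop

/-- The closed linear span of `{eₙ : n ≥ k}`. -/
def HPlus {H : Type*} [NormedAddCommGroup H] [InnerProductSpace ℂ H]
    (e : HilbertBasis ℤ ℂ H) (k : ℤ) : Submodule ℂ H :=
  (Submodule.span ℂ (e '' Set.Ici k)).topologicalClosure

end BilateralShift

open Filter Topology

namespace BilateralShift

/-! Write `cₙ = xₙ / βₙ` and `hₙ = yₙ / βₙ`. Then `(S - z) y = x` becomes the scalar recurrence `hₙ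
- z hₙ₊₁ = cₙ₊₁`. Let `l` be the first index with `c_l ≠ 0`.

Left of `l` a solution is geometric, and `r₂⁻ = 0` makes such a `y` unbounded unless it vanishes
there (`repr_solution_eq_zero`). The recurrence then telescopes: the partial sums of `F(z) = ∑
c_{l+i} zⁱ` are `-z^{j+1} h_{l+j}`. As `|hₙ| ≤ ‖y‖ / βₙ`, they tend to `0` along a subsequence if `0
< |z| < r₃⁺`, so `F(z) = 0` wherever a solution exists and `0 < |z| < min(r₃⁺, R⁺)`. But `F` is
analytic on that disc and `F(0) = c_l ≠ 0`, so it vanishes on no open set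
(`notMem_of_solution_of_norm_lt`). This gives (b) and one inclusion of (a).

For the other inclusion, let `r₃⁺ < R⁺` and `|z| > r₃⁺`. Solving the recurrence from `h_l = -c_l /
z` gives a series for `y` that converges locally uniformly in `z`
(`notMem_localSpectrum_of_r3Plus_lt`). -/

theorem beta_pos {ω : ℤ → ℝ} (hω : ∀ n, 0 < ω n) (n : ℤ) : 0 < beta ω n := by
  unfold beta
  split_ifs
  · exact Finset.prod_pos fun i _ => hω i
  · exact one_div_pos.2 (Finset.prod_pos fun i _ => hω i)

theorem beta_add_one {ω : ℤ → ℝ} (hω : ∀ n, 0 < ω n) (n : ℤ) :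
    beta ω (n + 1) = ω n * beta ω n := by
  have hn := (hω n).ne'
  rcases lt_trichotomy n (-1) with h | h | h
  · have h1 : ¬ (0 ≤ n + 1) := by lia
    have h2 : ¬ (0 ≤ n) := by lia
    have h3 : Finset.Ico n 0 = insert n (Finset.Ico (n + 1) 0) := by ext; simp; lia
    simp only [beta, h1, h2, if_false]
    rw [h3, Finset.prod_insert (by simp)]
    field_simp
  · subst h
    have h3 : Finset.Ico (-1 : ℤ) 0 = {-1} := by ext; simp; lia
    simp [beta, h3, hn]
  · have h1 : 0 ≤ n + 1 := by lia
    have h2 : 0 ≤ n := by lia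
    have h3 : Finset.Ico 0 (n + 1) = insert n (Finset.Ico 0 n) := by ext; simp; lia
    simp only [beta, h1, h2, if_true]
    rw [h3, Finset.prod_insert (by simp)]

/-! ### Root-test quantities as geometric bounds -/

/-- A bound by a geometric sequence that holds near `+∞` holds on every half-line, up to a
constant factor. -/
theorem exists_le_mul_zpow {u : ℤ → ℝ} {q : ℝ} (hq : 0 < q)
    (h : ∀ᶠ n : ℕ in atTop, u n ≤ q ^ n) (k : ℤ) :
    ∃ C, 0 < C ∧ ∀ n, k ≤ n → u n ≤ C * q ^ n := by
  obtain ⟨N, hN⟩ := eventually_atTop.1 h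
  have hs : 0 ≤ ∑ n ∈ Finset.Icc k N, |u n| / q ^ n :=
    Finset.sum_nonneg fun n _ => by positivity
  -- The sum absorbs the finitely many `n ≤ N`; the `1` makes the constant large enough for the
  -- tail.
  refine ⟨1 + ∑ n ∈ Finset.Icc k N, |u n| / q ^ n, by positivity, fun n hn => ?_⟩
  rcases le_total n N with h1 | h1
  · have h2 : |u n| / q ^ n ≤ ∑ n ∈ Finset.Icc k N, |u n| / q ^ n :=
      Finset.single_le_sum (f := fun n => |u n| / q ^ n) (fun n _ => by positivity)
        (Finset.mem_Icc.2 ⟨hn, h1⟩)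
    have h3 : |u n| = |u n| / q ^ n * q ^ n := by field_simp
    calc u n ≤ |u n| := le_abs_self _
      _ = |u n| / q ^ n * q ^ n := h3
      _ ≤ _ := by gcongr; linarith
  · obtain ⟨m, rfl⟩ := Int.eq_ofNat_of_zero_le (by lia : 0 ≤ n)
    have h2 := hN m (by lia)
    have h3 : (0 : ℝ) < q ^ m := by positivity
    simp only [zpow_natCast] at *
    nlinarith

theorem rpow_one_div_lt_iff {n : ℕ} (hn : 0 < n) {a t : ℝ≥0∞} :
    a ^ (1 / (n : ℝ)) < t ↔ a < t ^ n := by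
  rw [one_div, ENNReal.rpow_inv_lt_iff (by exact_mod_cast hn), ENNReal.rpow_natCast]

theorem lt_rpow_one_div_iff {n : ℕ} (hn : 0 < n) {a t : ℝ≥0∞} :
    t < a ^ (1 / (n : ℝ)) ↔ t ^ n < a := by
  rw [one_div, ENNReal.lt_rpow_inv_iff (by exact_mod_cast hn), ENNReal.rpow_natCast]

theorem eventually_beta_lt {ω : ℤ → ℝ} {ρ : ℝ} (hρ : 0 < ρ) (h : r3Plus ω < ENNReal.ofReal ρ) :
    ∀ᶠ n : ℕ in atTop, beta ω n < ρ ^ n := by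
  filter_upwards [eventually_lt_of_limsup_lt h, eventually_gt_atTop 0] with n h1 hn
  rw [rpow_one_div_lt_iff hn, ← ENNReal.ofReal_pow hρ.le] at h1
  exact (ENNReal.ofReal_lt_ofReal_iff (by positivity)).1 h1

theorem frequently_lt_beta {ω : ℤ → ℝ} {ρ : ℝ} (hρ : 0 ≤ ρ) (h : ENNReal.ofReal ρ < r3Plus ω) :
    ∃ᶠ n : ℕ in atTop, ρ ^ n < beta ω n := by
  refine ((frequently_lt_of_lt_limsup (by isBoundedDefault) h).and_eventually
    (eventually_gt_atTop 0)).mono fun n ⟨h1, hn⟩ => ?_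
  rw [lt_rpow_one_div_iff hn, ← ENNReal.ofReal_pow hρ] at h1
  exact (ENNReal.ofReal_lt_ofReal_iff_of_nonneg (by positivity)).1 h1

theorem frequently_inv_beta_neg_lt {ω : ℤ → ℝ} (h : r2Minus ω = 0) {ε : ℝ} (hε : 0 < ε) :
    ∃ᶠ n : ℕ in atTop, 1 / beta ω (-(n : ℤ)) < ε ^ n := by
  have h0 : r2Minus ω < ENNReal.ofReal ε := by simpa [h] using hε
  refine ((frequently_lt_of_liminf_lt (by isBoundedDefault) h0).and_eventually
    (eventually_gt_atTop 0)).mono fun n ⟨h1, hn⟩ => ?_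
  rw [rpow_one_div_lt_iff hn, ← ENNReal.ofReal_pow hε.le] at h1
  exact (ENNReal.ofReal_lt_ofReal_iff (by positivity)).1 h1

variable {H : Type*} [NormedAddCommGroup H] [InnerProductSpace ℂ H]

theorem eventually_repr_mul_pow_lt {e : HilbertBasis ℤ ℂ H} {ω : ℤ → ℝ} {x : H} {ρ : ℝ}
    (hρ : 0 ≤ ρ) (h : ENNReal.ofReal ρ < RPlus e ω x) :
    ∀ᶠ n : ℕ in atTop, ‖e.repr x (n : ℤ)‖ * ρ ^ n < beta ω n ∨ e.repr x (n : ℤ) = 0 := by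
  filter_upwards [eventually_lt_of_lt_liminf h, eventually_gt_atTop 0] with n h1 hn
  refine or_iff_not_imp_right.2 fun h0 => ?_
  rw [lt_rpow_one_div_iff hn, ← ENNReal.ofReal_pow hρ,
    ENNReal.lt_div_iff_mul_lt (by simp [h0]) (by simp), ← ofReal_norm,
    ← ENNReal.ofReal_mul (by positivity), mul_comm] at h1
  exact (ENNReal.ofReal_lt_ofReal_iff_of_nonneg (by positivity)).1 h1

/-- Below `R⁺(x)` the coefficients `aₙ / βₙ` are bounded geometrically on half-lines. -/
theorem exists_norm_repr_div_beta_le {e : HilbertBasis ℤ ℂ H} {ω : ℤ → ℝ} (hω : ∀ n, 0 < ω n)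
    {x : H} {ρ : ℝ} (hρ : 0 < ρ) (h : ENNReal.ofReal ρ < RPlus e ω x) (k : ℤ) :
    ∃ C, 0 < C ∧ ∀ n, k ≤ n → ‖e.repr x n / beta ω n‖ ≤ C * ρ⁻¹ ^ n := by
  refine exists_le_mul_zpow (u := fun n => ‖e.repr x n / beta ω n‖) (inv_pos.2 hρ) ?_ k
  filter_upwards [eventually_repr_mul_pow_lt hρ.le h] with n hn
  have hb := beta_pos hω n
  rw [norm_div, Complex.norm_real, Real.norm_of_nonneg hb.le, inv_pow, div_le_iff₀ hb]
  rcases hn with hn | hn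
  · rw [inv_mul_eq_div, le_div_iff₀ (by positivity)]
    exact hn.le
  · rw [hn, norm_zero]
    positivity

/-! ### Coordinates of vectors and of their shifts -/

theorem norm_repr_le (e : HilbertBasis ℤ ℂ H) (y : H) (n : ℤ) : ‖e.repr y n‖ ≤ ‖y‖ := by
  rw [e.repr_apply_apply]
  simpa [e.orthonormal.norm_eq_one] using norm_inner_le_norm (𝕜 := ℂ) (e n) y

theorem repr_shift_add_one {e : HilbertBasis ℤ ℂ H} {ω : ℤ → ℝ} {S : H →L[ℂ] H}
    (hS : IsBilateralWeightedShift e ω S) (y : H) (n : ℤ) :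
    e.repr (S y) (n + 1) = ω n * e.repr y n := by
  have h1 := ((e.hasSum_repr y).mapL S).mapL (innerSL ℂ (e (n + 1)))
  have h2 : ∀ m, inner ℂ (e (n + 1)) (S (e.repr y m • e m)) =
      if m = n then ω n * e.repr y n else 0 := by
    intro m
    rw [map_smul, hS.apply_basis, inner_smul_right, inner_smul_right,
      orthonormal_iff_ite.1 e.orthonormal]
    split_ifs with h3 h4 h4
    · subst h4; ring
    · lia
    · lia
    · simp
  simp only [innerSL_apply_apply, h2] at h1
  rw [e.repr_apply_apply]
  exact h1.unique (hasSum_ite_eq n _)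

theorem repr_eq_zero_of_mem_HPlus {e : HilbertBasis ℤ ℂ H} {k : ℤ} {x : H} (hx : x ∈ HPlus e k)
    {n : ℤ} (hn : n < k) : e.repr x n = 0 := by
  have h : HPlus e k ≤ (innerSL ℂ (e n)).ker := by
    refine Submodule.topologicalClosure_minimal _ (Submodule.span_le.2 ?_)
      (innerSL ℂ (e n)).isClosed_ker
    rintro _ ⟨m, hm, rfl⟩
    have hm' : n ≠ m := by have := Set.mem_Ici.1 hm; lia
    simpa using e.orthonormal.2 hm'
  rw [e.repr_apply_apply]
  simpa using h hx

/-- A non-zero vector of `HPlus e k` has a first non-zero coordinate. -/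
theorem exists_first_coord {e : HilbertBasis ℤ ℂ H} {k : ℤ} {x : H} (hx : x ∈ HPlus e k)
    (hx0 : x ≠ 0) : ∃ l, e.repr x l ≠ 0 ∧ ∀ n < l, e.repr x n = 0 := by
  obtain ⟨l, hl, hmin⟩ := Int.exists_least_of_bdd (P := fun n => e.repr x n ≠ 0)
    ⟨k, fun z hz => by by_contra! h; exact hz (repr_eq_zero_of_mem_HPlus hx h)⟩ (by
      by_contra! h
      exact hx0 (e.repr.map_eq_zero_iff.1 (lp.ext (funext h))))
  exact ⟨l, hl, fun n hn => by by_contra h; exact absurd (hmin n h) (by lia)⟩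

/-! ### Vanishing of solutions to the left -/

section Necessary

variable {e : HilbertBasis ℤ ℂ H} {ω : ℤ → ℝ} {S : H →L[ℂ] H}

/-- The resolvent equation in the coordinates `yₙ / βₙ`. -/
theorem repr_div_beta_sub (hS : IsBilateralWeightedShift e ω S) {x y : H} {z : ℂ}
    (h : S y - z • y = x) (n : ℤ) :
    e.repr y n / beta ω n - z * (e.repr y (n + 1) / beta ω (n + 1)) =
      e.repr x (n + 1) / beta ω (n + 1) := by
  have h1 : e.repr x (n + 1) = ω n * e.repr y n - z * e.repr y (n + 1) := by
    rw [← h, map_sub, map_smul, lp.coeFn_sub, Pi.sub_apply, lp.coeFn_smul, Pi.smul_apply,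
      repr_shift_add_one hS, smul_eq_mul]
  have hω : (ω n : ℂ) ≠ 0 := by exact_mod_cast (hS.weight_pos n).ne'
  have hb : (beta ω n : ℂ) ≠ 0 := by exact_mod_cast (beta_pos hS.weight_pos n).ne'
  rw [h1, beta_add_one hS.weight_pos]
  push_cast
  field_simp

/-- If `r₂⁻ = 0` and `x` has no coordinates below `k`, neither has a solution `y` of
`(S - z) y = x` with `z ≠ 0`. -/
theorem repr_solution_eq_zero (hS : IsBilateralWeightedShift e ω S) (hr : r2Minus ω = 0)
    {k : ℤ} {x y : H} (hx : ∀ n < k, e.repr x n = 0) {z : ℂ} (hz : z ≠ 0)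
    (h : S y - z • y = x) {m : ℤ} (hm : m < k) : e.repr y m = 0 := by
  by_contra hy
  have hβ := beta_pos hS.weight_pos
  have hstep : ∀ j : ℕ, e.repr y (m - j) / beta ω (m - j) = z ^ j * (e.repr y m / beta ω m) := by
    intro j
    induction j with
    | zero => simp
    | succ j ih =>
      have h1 := repr_div_beta_sub hS h (m - (j + 1))
      rw [show m - ((j : ℤ) + 1) + 1 = m - j by ring, hx _ (by lia), zero_div, sub_eq_zero, ih] at h1
      push_cast
      rw [h1]
      ring
  have hz' : 0 < ‖z‖ := norm_pos_iff.2 hz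
  have hc : 0 < ‖e.repr y m‖ / beta ω m := div_pos (norm_pos_iff.2 hy) (hβ m)
  set c := ‖e.repr y m‖ / beta ω m with hcdef
  have hbound : ∀ n : ℤ, n ≤ m → ‖z‖ ^ (m - n) * c * beta ω n ≤ ‖y‖ := by
    intro n hn
    obtain ⟨j, hj⟩ := Int.eq_ofNat_of_zero_le (by lia : 0 ≤ m - n)
    obtain rfl : n = m - j := by lia
    have h1 := congrArg norm (hstep j)
    rw [norm_mul, norm_div, norm_div, Complex.norm_real, Complex.norm_real, norm_pow,
      Real.norm_of_nonneg (hβ _).le, Real.norm_of_nonneg (hβ _).le, div_eq_iff (hβ _).ne'] at h1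
    rw [show m - (m - (j : ℤ)) = j by ring, zpow_natCast, ← h1]
    exact norm_repr_le e y _
  have htend : Tendsto (fun n : ℕ => (2 : ℝ) ^ n) atTop atTop :=
    tendsto_pow_atTop_atTop_of_one_lt one_lt_two
  -- With `ε = ‖z‖ / 2`, `h1` becomes `2 ^ n < β₋ₙ ‖z‖ ^ n`, which contradicts `hbound` at `-n` once
  -- `2 ^ n` is large.
  obtain ⟨n, h1, h2, h3⟩ := ((frequently_inv_beta_neg_lt hr (half_pos hz')).and_eventually
    ((htend.eventually_gt_atTop (‖y‖ / (‖z‖ ^ m * c))).and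
      (eventually_ge_atTop (-m).toNat))).exists
  have h4 := hbound (-n) (by lia)
  rw [div_lt_iff₀ (by positivity)] at h2
  rw [one_div_lt (hβ _) (by positivity), div_pow, one_div_div, div_lt_iff₀ (by positivity)] at h1
  have h5 : ‖z‖ ^ (m - -(n : ℤ)) = ‖z‖ ^ m * ‖z‖ ^ n := by
    rw [sub_neg_eq_add, zpow_add₀ hz'.ne', zpow_natCast]
  rw [h5] at h4
  have h6 : 2 ^ n * (‖z‖ ^ m * c) < beta ω (-n) * ‖z‖ ^ n * (‖z‖ ^ m * c) := by gcongr
  nlinarith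

end Necessary

end BilateralShift

namespace BilateralShift

variable {H : Type*} [NormedAddCommGroup H] [InnerProductSpace ℂ H]
  {e : HilbertBasis ℤ ℂ H} {ω : ℤ → ℝ} {S : H →L[ℂ] H}

/-! ### The disc contained in the local spectrum -/

/-- Coordinate `k - 1` of `f z` vanishes for `z ≠ 0`, hence at `0` by continuity; but `S (f 0) = x`
would then force `x` to have coordinate `0` at `k`. -/
theorem zero_notMem_of_solution (hS : IsBilateralWeightedShift e ω S) (hr : r2Minus ω = 0)
    {k : ℤ} {x : H} (hxk : e.repr x k ≠ 0) (hx : ∀ n < k, e.repr x n = 0) {U : Set ℂ}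
    (hU : IsOpen U) {f : ℂ → H} (hf : ContinuousOn f U) (h : ∀ z ∈ U, S (f z) - z • f z = x) :
    (0 : ℂ) ∉ U := by
  intro h0
  have hcont : Tendsto (fun z => inner ℂ (e (k - 1)) (f z)) (𝓝[≠] 0)
      (𝓝 (inner ℂ (e (k - 1)) (f 0))) :=
    (tendsto_const_nhds.inner (hf.continuousAt (hU.mem_nhds h0))).mono_left nhdsWithin_le_nhds
  have hzero : (fun z => inner ℂ (e (k - 1)) (f z)) =ᶠ[𝓝[≠] 0] fun _ => 0 := by
    filter_upwards [self_mem_nhdsWithin, mem_nhdsWithin_of_mem_nhds (hU.mem_nhds h0)] with z hz hzU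
    rw [← e.repr_apply_apply]
    exact repr_solution_eq_zero hS hr hx hz (h z hzU) (by lia)
  have h1 : e.repr (f 0) (k - 1) = 0 := by
    rw [e.repr_apply_apply]
    exact tendsto_nhds_unique hcont (hzero.tendsto)
  have h2 : e.repr (S (f 0)) (k - 1 + 1) = 0 := by rw [repr_shift_add_one hS, h1, mul_zero]
  have h3 := h 0 h0
  rw [zero_smul, sub_zero] at h3
  rw [h3, sub_add_cancel] at h2
  exact hxk h2

theorem sum_coeff_mul_pow_eq (hS : IsBilateralWeightedShift e ω S) (hr : r2Minus ω = 0)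
    {k : ℤ} {x y : H} (hx : ∀ n < k, e.repr x n = 0) {z : ℂ} (hz : z ≠ 0)
    (h : S y - z • y = x) (j : ℕ) :
    ∑ i ∈ Finset.range (j + 1), e.repr x (k + i) / beta ω (k + i) * z ^ i =
      -(z ^ (j + 1) * (e.repr y (k + j) / beta ω (k + j))) := by
  induction j with
  | zero =>
    have h1 := repr_div_beta_sub hS h (k - 1)
    rw [repr_solution_eq_zero hS hr hx hz h (by lia), sub_add_cancel] at h1
    simp [← h1]
  | succ j ih =>
    have h1 := repr_div_beta_sub hS h (k + j)
    rw [Finset.sum_range_succ, ih]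
    push_cast
    rw [← add_assoc, ← h1]
    ring

theorem tsum_coeff_mul_pow_eq_zero (hS : IsBilateralWeightedShift e ω S) (hr : r2Minus ω = 0)
    {k : ℤ} {x y : H} (hx : ∀ n < k, e.repr x n = 0) {z : ℂ} (hz : z ≠ 0)
    (h : S y - z • y = x) {ρ : ℝ} (hzρ : ‖z‖ < ρ) (hρ : ENNReal.ofReal ρ < r3Plus ω)
    (hsum : Summable fun i : ℕ => e.repr x (k + i) / beta ω (k + i) * z ^ i) :
    ∑' i : ℕ, e.repr x (k + i) / beta ω (k + i) * z ^ i = 0 := by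
  have hβ := beta_pos hS.weight_pos
  have hz' : 0 < ‖z‖ := norm_pos_iff.2 hz
  have hρ0 : 0 < ρ := hz'.trans hzρ
  set F := ∑' i : ℕ, e.repr x (k + i) / beta ω (k + i) * z ^ i with hF
  by_contra hF0
  have hF' : 0 < ‖F‖ := norm_pos_iff.2 hF0
  -- Reindexes the partial sums so that the last term has index `n`, where `βₙ > ρⁿ` for infinitely
  -- many `n`.
  have hj : Tendsto (fun n : ℕ => ((n : ℤ) - k).toNat + 1) atTop atTop := by
    refine tendsto_atTop_mono (f := fun n : ℕ => n - k.toNat) (fun n => by lia) ?_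
    exact tendsto_sub_atTop_nat _
  have hlim := (hsum.hasSum.tendsto_sum_nat.comp hj).norm
  have hev := hlim.eventually_const_lt (half_lt_self hF')
  have hgeo : Tendsto (fun n : ℕ => (‖z‖ * ‖z‖ ^ (-k) * ‖y‖) * (‖z‖ / ρ) ^ n) atTop (𝓝 0) := by
    simpa using (tendsto_pow_atTop_nhds_zero_of_lt_one (by positivity)
      ((div_lt_one hρ0).2 hzρ)).const_mul (‖z‖ * ‖z‖ ^ (-k) * ‖y‖)
  obtain ⟨n, h1, h2, h3, h4⟩ := ((frequently_lt_beta hρ0.le hρ).and_eventually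
    (hev.and ((hgeo.eventually_lt_const (half_pos hF')).and
      (eventually_ge_atTop k.toNat)))).exists
  simp only [Function.comp_apply] at h2
  have hnj : k + (((n : ℤ) - k).toNat : ℤ) = n := by lia
  have hpow : ‖z‖ ^ ((n : ℤ) - k).toNat = ‖z‖ ^ n * ‖z‖ ^ (-k) := by
    rw [← zpow_natCast, ← zpow_natCast, ← zpow_add₀ hz'.ne']
    congr 1
    lia
  rw [sum_coeff_mul_pow_eq hS hr hx hz h, hnj, norm_neg, norm_mul, norm_div, Complex.norm_real,
    Real.norm_of_nonneg (hβ _).le, norm_pow, pow_succ, hpow] at h2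
  have h5 : ‖e.repr y n‖ / beta ω n ≤ ‖y‖ / ρ ^ n :=
    div_le_div₀ (norm_nonneg _) (norm_repr_le e y n) (by positivity) h1.le
  have h6 : ‖z‖ ^ n * ‖z‖ ^ (-k) * ‖z‖ * (‖e.repr y n‖ / beta ω n) ≤
      ‖z‖ ^ n * ‖z‖ ^ (-k) * ‖z‖ * (‖y‖ / ρ ^ n) := by gcongr
  have h7 : ‖z‖ ^ n * ‖z‖ ^ (-k) * ‖z‖ * (‖y‖ / ρ ^ n) =
      (‖z‖ * ‖z‖ ^ (-k) * ‖y‖) * (‖z‖ / ρ) ^ n := by rw [div_pow]; ring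
  linarith

/-- Geometric majorant of the power series with coefficients `aₖ₊ᵢ / βₖ₊ᵢ` inside its disc of
convergence. -/
theorem exists_summable_bound_coeff (hS : IsBilateralWeightedShift e ω S) {x : H} {r : ℝ}
    (hr0 : 0 < r) (hr : ENNReal.ofReal r < RPlus e ω x) (k : ℤ) :
    ∃ u : ℕ → ℝ, Summable u ∧ ∀ i : ℕ, ∀ z ∈ Metric.ball (0 : ℂ) r,
      ‖e.repr x (k + i) / beta ω (k + i) * z ^ i‖ ≤ u i := by
  obtain ⟨ρ, -, hrρ, hρ⟩ := ENNReal.lt_iff_exists_real_btwn.1 hr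
  have hrρ' : r < ρ := (ENNReal.ofReal_lt_ofReal_iff_of_nonneg hr0.le).1 hrρ
  have hρ0 : 0 < ρ := hr0.trans hrρ'
  obtain ⟨C, hC, hb⟩ := exists_norm_repr_div_beta_le hS.weight_pos hρ0 hρ k
  refine ⟨fun i => C * ρ⁻¹ ^ k * (r / ρ) ^ i, (summable_geometric_of_lt_one (by positivity)
    ((div_lt_one hρ0).2 hrρ')).mul_left _, fun i z hz => ?_⟩
  rw [mem_ball_zero_iff] at hz
  have h1 := hb (k + i) (by lia)
  rw [zpow_add₀ (inv_pos.2 hρ0).ne', zpow_natCast] at h1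
  calc ‖e.repr x (k + i) / beta ω (k + i) * z ^ i‖
      = ‖e.repr x (k + i) / beta ω (k + i)‖ * ‖z‖ ^ i := by rw [norm_mul, norm_pow]
    _ ≤ C * (ρ⁻¹ ^ k * ρ⁻¹ ^ i) * r ^ i := by gcongr
    _ = C * ρ⁻¹ ^ k * (r / ρ) ^ i := by rw [div_eq_mul_inv, mul_pow]; ring

theorem notMem_of_solution_of_norm_lt (hS : IsBilateralWeightedShift e ω S) (hr : r2Minus ω = 0)
    {k : ℤ} {x : H} (hxk : e.repr x k ≠ 0) (hx : ∀ n < k, e.repr x n = 0) {U : Set ℂ}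
    (hU : IsOpen U) {f : ℂ → H} (h : ∀ z ∈ U, S (f z) - z • f z = x)
    {z : ℂ} (hz : z ≠ 0) (h3 : ‖z‖ₑ < r3Plus ω) (hR : ‖z‖ₑ < RPlus e ω x) : z ∉ U := by
  intro hzU
  obtain ⟨r, -, hzr, hr'⟩ := ENNReal.lt_iff_exists_real_btwn.1 (lt_min h3 hR)
  rw [← ofReal_norm, ENNReal.ofReal_lt_ofReal_iff_of_nonneg (norm_nonneg _)] at hzr
  have hr0 : 0 < r := (norm_nonneg z).trans_lt hzr
  obtain ⟨u, hu, hub⟩ := exists_summable_bound_coeff hS hr0 (hr'.trans_le (min_le_right _ _)) k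
  set F : ℂ → ℂ := fun z => ∑' i : ℕ, e.repr x (k + i) / beta ω (k + i) * z ^ i with hF
  have hFan : AnalyticOnNhd ℂ F (Metric.ball 0 r) :=
    (Complex.differentiableOn_tsum_of_summable_norm hu (fun i => by fun_prop) Metric.isOpen_ball
      hub).analyticOnNhd Metric.isOpen_ball
  have hzb : z ∈ Metric.ball (0 : ℂ) r := mem_ball_zero_iff.2 hzr
  have hev : F =ᶠ[𝓝 z] 0 := by
    filter_upwards [hU.mem_nhds hzU, Metric.isOpen_ball.mem_nhds hzb, isOpen_ne.mem_nhds hz]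
      with w hwU hwb hw0
    exact tsum_coeff_mul_pow_eq_zero hS hr hx hw0 (h w hwU) (mem_ball_zero_iff.1 hwb)
      (hr'.trans_le (min_le_left _ _)) (Summable.of_norm_bounded hu fun i => hub i w hwb)
  have h0 := hFan.eqOn_zero_of_preconnected_of_eventuallyEq_zero
    (convex_ball _ _).isPreconnected hzb hev (Metric.mem_ball_self hr0)
  have h1 : F 0 = e.repr x k / beta ω k := by
    simp only [hF]
    rw [tsum_eq_single 0 (fun i hi => by simp [hi])]
    simp
  rw [h1, Pi.zero_apply, div_eq_zero_iff] at h0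
  exact h0.elim hxk (by exact_mod_cast (beta_pos hS.weight_pos k).ne')

theorem mem_localSpectrum_of_le (hS : IsBilateralWeightedShift e ω S) (hr : r2Minus ω = 0)
    {k : ℤ} {x : H} (hxk : e.repr x k ≠ 0) (hx : ∀ n < k, e.repr x n = 0)
    {z : ℂ} (h3 : ‖z‖ₑ ≤ r3Plus ω) (hR : ‖z‖ₑ ≤ RPlus e ω x) : z ∈ localSpectrum S x := by
  rintro ⟨U, ⟨hU, f, hf, h⟩, hzU⟩
  have hz : z ≠ 0 := by
    rintro rfl
    exact zero_notMem_of_solution hS hr hxk hx hU hf.continuousOn h hzU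
  -- Boundary points reduce to interior ones: an open `U` containing `z` also contains `t z` for
  -- some `0 < t < 1`.
  have hcont : Tendsto (fun t : ℝ => (t : ℂ) * z) (𝓝[<] 1) (𝓝 z) := by
    have : ContinuousAt (fun t : ℝ => (t : ℂ) * z) 1 := by fun_prop
    simpa using this.tendsto.mono_left nhdsWithin_le_nhds
  obtain ⟨t, htU, ht⟩ := ((hcont.eventually (hU.mem_nhds hzU)).and
    (Ioo_mem_nhdsLT (zero_lt_one (α := ℝ)))).exists
  have hlt : ‖(t : ℂ) * z‖ₑ < ‖z‖ₑ := by
    rw [← ofReal_norm, ← ofReal_norm, ENNReal.ofReal_lt_ofReal_iff (norm_pos_iff.2 hz), norm_mul,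
      Complex.norm_real, Real.norm_of_nonneg ht.1.le]
    exact mul_lt_of_lt_one_left (norm_pos_iff.2 hz) ht.2
  exact notMem_of_solution_of_norm_lt hS hr hxk hx hU h
    (mul_ne_zero (by exact_mod_cast ht.1.ne') hz) (hlt.trans_le h3) (hlt.trans_le hR) htU

/-! ### Analytic solutions outside the disc -/

/-- The solution of `zh₀ = -c₀`, `zhₙ₊₁ = hₙ - cₙ₊₁`. -/
noncomputable def resolventCoeff (c : ℕ → ℂ) : ℕ → ℂ → ℂ
  | 0, z => -c 0 / z
  | n + 1, z => (resolventCoeff c n z - c (n + 1)) / z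

theorem differentiableOn_resolventCoeff (c : ℕ → ℂ) (n : ℕ) :
    DifferentiableOn ℂ (resolventCoeff c n) {0}ᶜ := by
  induction n with
  | zero =>
    exact (differentiableOn_const _).div differentiableOn_id fun z hz => hz
  | succ n ih =>
    exact (ih.sub (differentiableOn_const _)).div differentiableOn_id fun z hz => hz

/-- The factor `1 / (‖z‖ - q)` is preserved by the recurrence, since `1 / (‖z‖ - q) + 1 / q = ‖z‖ /
(q (‖z‖ - q))`. -/
theorem norm_resolventCoeff_le {c : ℕ → ℂ} {C q : ℝ} (hC : 0 ≤ C) (hq : 0 < q)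
    (hc : ∀ n, ‖c n‖ ≤ C * q⁻¹ ^ n) {z : ℂ} (hz : q < ‖z‖) (n : ℕ) :
    ‖resolventCoeff c n z‖ ≤ C * q⁻¹ ^ n / (‖z‖ - q) := by
  have h0 : 0 < ‖z‖ := hq.trans hz
  have h1 : 0 < ‖z‖ - q := sub_pos.2 hz
  induction n with
  | zero =>
    rw [resolventCoeff, norm_div, norm_neg]
    exact div_le_div₀ (by positivity) (hc 0) h1 (by linarith)
  | succ n ih =>
    rw [resolventCoeff, norm_div, div_le_iff₀ h0]
    calc ‖resolventCoeff c n z - c (n + 1)‖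
        ≤ C * q⁻¹ ^ n / (‖z‖ - q) + C * q⁻¹ ^ (n + 1) :=
          (norm_sub_le _ _).trans (add_le_add ih (hc _))
      _ = C * q⁻¹ ^ (n + 1) / (‖z‖ - q) * ‖z‖ := by
          rw [pow_succ]
          field_simp
          ring

theorem hasSum_nat_repr {k : ℤ} {x : H} (hx : ∀ n < k, e.repr x n = 0) :
    HasSum (fun i : ℕ => e.repr x (k + i) • e (k + i)) x := by
  have hinj : Function.Injective fun i : ℕ => k + (i : ℤ) := fun i j h => by simpa using h
  have hoff : ∀ n ∉ Set.range (fun i : ℕ => k + (i : ℤ)), e.repr x n • e n = 0 := by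
    intro n hn
    have hnk : n < k := by
      by_contra! h
      exact hn ⟨(n - k).toNat, by dsimp only; lia⟩
    rw [hx n hnk, zero_smul]
  have h := (Function.Injective.hasSum_iff (f := fun n => e.repr x n • e n) hinj hoff).2
    (e.hasSum_repr x)
  exact h

theorem resolvent_equation (hS : IsBilateralWeightedShift e ω S) {k : ℤ} {x : H}
    (hx : ∀ n < k, e.repr x n = 0) {z : ℂ} (hz : z ≠ 0) {y : H}
    (hy : HasSum (fun i : ℕ => (resolventCoeff
      (fun i : ℕ => e.repr x (k + i) / beta ω (k + i)) i z * beta ω (k + i)) • e (k + i)) y) :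
    S y - z • y = x := by
  set h := resolventCoeff (fun i : ℕ => e.repr x (k + i) / beta ω (k + i)) with hdef
  have hb : ∀ n, (beta ω n : ℂ) ≠ 0 := fun n => by
    exact_mod_cast (beta_pos hS.weight_pos n).ne'
  have h1 := hy.mapL S
  -- Dropping the zeroth term of `z • y` aligns it with `S y`: both `i`-th terms are multiples of `e
  -- (k + i + 1)`.
  have h2 := (hasSum_nat_add_iff' 1).2 (hy.const_smul z)
  have h3 := (hasSum_nat_add_iff' 1).2 (hasSum_nat_repr hx)
  have h4 := h1.sub h2
  have h5 : z • (h 0 z * beta ω k) • e k = -(e.repr x k • e k) := by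
    have := hb k
    simp only [hdef, resolventCoeff]
    rw [smul_smul, ← neg_smul]
    congr 1
    simp only [Nat.cast_zero, add_zero]
    field_simp
  have h6 : ∀ i : ℕ, S ((h i z * beta ω (k + i)) • e (k + i)) -
      z • (h (i + 1) z * beta ω (k + (i + 1 : ℕ))) • e (k + (i + 1 : ℕ)) =
      e.repr x (k + (i + 1 : ℕ)) • e (k + (i + 1 : ℕ)) := by
    intro i
    have hb1 := hb (k + (i + 1 : ℕ))
    have hb2 : (beta ω (k + (i + 1 : ℕ)) : ℂ) = ω (k + i) * beta ω (k + i) := by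
      push_cast
      rw [← add_assoc, beta_add_one hS.weight_pos]
      push_cast
      rfl
    have hzh : z * h (i + 1) z =
        h i z - e.repr x (k + (i + 1 : ℕ)) / beta ω (k + (i + 1 : ℕ)) := by
      simp only [hdef, resolventCoeff]
      field_simp
    rw [map_smul, hS.apply_basis, smul_smul, smul_smul, ← mul_assoc, hzh,
      show k + (i : ℤ) + 1 = k + (i + 1 : ℕ) by push_cast; ring, ← sub_smul]
    congr 1
    rw [sub_mul, div_mul_cancel₀ _ hb1, hb2]
    ring
  simp only [h6] at h4
  have h7 := h4.unique h3
  simp only [Finset.sum_range_one, Nat.cast_zero, add_zero, h5] at h7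
  rw [sub_neg_eq_add, ← sub_sub] at h7
  exact sub_left_injective h7

theorem notMem_localSpectrum_of_r3Plus_lt [CompleteSpace H]
    (hS : IsBilateralWeightedShift e ω S) {k : ℤ} {x : H}
    (hx : ∀ n < k, e.repr x n = 0) (hR : r3Plus ω < RPlus e ω x)
    {z : ℂ} (hz : r3Plus ω < ‖z‖ₑ) : z ∉ localSpectrum S x := by
  have hβ := beta_pos hS.weight_pos
  -- Choose `r₃⁺ < p < q < s < ‖z‖` with `q < R⁺`: `βₙ` is `O(pⁿ)` and the resolvent coefficients
  -- are `O(q⁻ⁿ)`, uniformly on `‖w‖ > s`, so the terms decay like `(p / q)ⁿ`.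
  obtain ⟨q, -, hq, hq'⟩ := ENNReal.lt_iff_exists_real_btwn.1 (lt_min hR hz)
  obtain ⟨p, -, hp, hpq⟩ := ENNReal.lt_iff_exists_real_btwn.1 hq
  have hp0 : 0 < p := ENNReal.ofReal_pos.1 (pos_of_gt hp)
  have hpq' : p < q := (ENNReal.ofReal_lt_ofReal_iff_of_nonneg hp0.le).1 hpq
  have hq0 : 0 < q := hp0.trans hpq'
  have hqz : q < ‖z‖ := by
    have := hq'.trans_le (min_le_right _ _)
    rwa [← ofReal_norm, ENNReal.ofReal_lt_ofReal_iff_of_nonneg hq0.le] at this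
  obtain ⟨s, hqs, hsz⟩ := exists_between hqz
  obtain ⟨C, hC, hc⟩ := exists_norm_repr_div_beta_le hS.weight_pos hq0
    (hq'.trans_le (min_le_left _ _)) k
  obtain ⟨D, hD, hd⟩ := exists_le_mul_zpow hp0
    ((eventually_beta_lt hp0 hp).mono fun n hn => hn.le) k
  set c : ℕ → ℂ := fun i => e.repr x (k + i) / beta ω (k + i) with hcdef
  have hc' : ∀ i, ‖c i‖ ≤ C * q⁻¹ ^ k * q⁻¹ ^ i := fun i => by
    rw [mul_assoc, ← zpow_natCast, ← zpow_add₀ (inv_pos.2 hq0).ne']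
    exact hc (k + i) (by lia)
  set U : Set ℂ := {w | s < ‖w‖} with hUdef
  have hU : IsOpen U := isOpen_lt continuous_const continuous_norm
  have hU0 : ∀ w ∈ U, w ≠ 0 := fun w hw => norm_pos_iff.1 (hq0.trans (hqs.trans hw))
  set t : ℕ → ℂ → H := fun i w => (resolventCoeff c i w * beta ω (k + i)) • e (k + i) with htdef
  set u : ℕ → ℝ := fun i => (C * q⁻¹ ^ k / (s - q) * (D * p ^ k)) * (p / q) ^ i with hudef
  have hu : Summable u := (summable_geometric_of_lt_one (by positivity)
    ((div_lt_one hq0).2 hpq')).mul_left _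
  have htu : ∀ i, ∀ w ∈ U, ‖t i w‖ ≤ u i := by
    intro i w hw
    have hsq : 0 < s - q := sub_pos.2 hqs
    have hw' : s < ‖w‖ := hw
    have h1 := norm_resolventCoeff_le (by positivity) hq0 hc' (hqs.trans hw') i
    have h2 := hd (k + i) (by lia)
    rw [zpow_add₀ hp0.ne', zpow_natCast] at h2
    have h3 : C * q⁻¹ ^ k * q⁻¹ ^ i / (‖w‖ - q) ≤ C * q⁻¹ ^ k * q⁻¹ ^ i / (s - q) := by gcongr
    rw [norm_smul, norm_mul, Complex.norm_real, Real.norm_of_nonneg (hβ _).le,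
      e.orthonormal.norm_eq_one, mul_one]
    calc _ ≤ (C * q⁻¹ ^ k * q⁻¹ ^ i / (s - q)) * (D * (p ^ k * p ^ i)) :=
          mul_le_mul (h1.trans h3) h2 (hβ _).le (by positivity)
      _ = u i := by rw [hudef]; simp only [div_pow, inv_pow]; ring
  have hdiff : DifferentiableOn ℂ (fun w => ∑' i, t i w) U :=
    Complex.differentiableOn_tsum_of_summable_norm hu (fun i =>
      (((differentiableOn_resolventCoeff c i).mono hU0).mul_const _).smul_const _) hU htu
  exact fun hmem => hmem ⟨U, ⟨hU, fun w => ∑' i, t i w, hdiff.analyticOnNhd hU, fun w hw =>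
    resolvent_equation hS hx (hU0 w hw)
      (Summable.of_norm_bounded hu fun i => htu i w hw).hasSum⟩, hsz⟩

end BilateralShift

theorem theorem4 {H : Type*} [NormedAddCommGroup H] [InnerProductSpace ℂ H] [CompleteSpace H]
    (e : HilbertBasis ℤ ℂ H) (ω : ℤ → ℝ) (S : H →L[ℂ] H)
    (hS : IsBilateralWeightedShift e ω S)
    (hr : BilateralShift.r2Minus ω = 0)
    (k : ℤ) (x : H) (hx : x ∈ BilateralShift.HPlus e k) (hx0 : x ≠ 0) :
    (BilateralShift.r3Plus ω < BilateralShift.RPlus e ω x →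
      localSpectrum S x = {z : ℂ | ‖z‖ₑ ≤ BilateralShift.r3Plus ω}) ∧
    (BilateralShift.RPlus e ω x ≤ BilateralShift.r3Plus ω →
      {z : ℂ | ‖z‖ₑ ≤ BilateralShift.RPlus e ω x} ⊆ localSpectrum S x) := by
  obtain ⟨l, hl, hlt⟩ := BilateralShift.exists_first_coord hx hx0
  refine ⟨fun h => Set.Subset.antisymm (fun z hz => ?_) fun z hz => ?_, fun h z hz => ?_⟩
  · by_contra hlarge
    exact BilateralShift.notMem_localSpectrum_of_r3Plus_lt hS hlt h (not_le.1 hlarge) hz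
  · exact BilateralShift.mem_localSpectrum_of_le hS hr hl hlt hz (hz.trans h.le)
  · exact BilateralShift.mem_localSpectrum_of_le hS hr hl hlt (hz.trans h) hz
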